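/- For integers $n \ge 0$, $r \ge 1$ let $H_n^{(r)} = \sum_{j=1}^{n} \frac{1}{j^r}$ (so $H_0^{(r)}=0$) and $H_n = H_n^{(1)}$. Let $P_k(y_1,\dots,y_k) \in \mathbb{Q}[y_1,\dots,y_k]$ be the polynomial that expresses the $k$-th elementary symmetric function $e_k$ through the power sums $p_i$, i.e. $P_k(p_1,\dots,p_k) = e_k$; thus $P_1 = y_1$, $P_2 = \frac12(y_1^2-y_2)$, $P_3=\frac16(y_1^3-3y_1y_2+2y_3)$, and in general $P_0=1$, $kP_k=\sum_{i=1}^{k}(-1)^{i-1}P_{k-i}\,y_i$. For positive integers $i_1,\dots,i_d$ with $i_1>1$ let $$\zeta(i_1,\dots,i_d)=\sum_{n_1>n_2>\dots>n_d\ge 1}\frac{1}{n_1^{i_1}n_2^{i_2}\cdots n_d^{i_d}}$$ be the multiple zeta value. Then for every integer $k\ge 1$ the following two series converge and $$\sum_{n=0}^\infty \frac{H_n\,P_k(H_n,H_n^{(2)},\dots,H_n^{(k)})}{(n+1)^2} = (k+2)\,\zeta(k+3)-\zeta(k+2,1),$$ $$\frac12\sum_{n=1}^\infty \frac{\bigl(H_n^2+H_n^{(2)}\bigr)\,P_k(H_n,H_n^{(2)},\dots,H_n^{(k)})}{(n+1)^2}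 = \binom{k+3}{2}\zeta(k+4)-(k+2)\,\zeta(k+3,1)-\zeta(k+2,2).$$ -/

import Mathlib

/-- The generalized harmonic number `H_n^{(r)} = ∑_{j=1}^n 1 / j ^ r` (so `H_0^{(r)} = 0`, and
`genHarmonic 1 n` is the ordinary harmonic number `H_n`). -/
noncomputable def genHarmonic (r n : ℕ) : ℝ :=
  ∑ j ∈ Finset.Icc 1 n, 1 / (j : ℝ) ^ r

/-- The multiple zeta value
`ζ(i_1, …, i_d) = ∑_{n_1 > n_2 > ⋯ > n_d ≥ 1} 1 / (n_1 ^ i_1 ⋯ n_d ^ i_d)`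
(a convergent series of positive terms when all `i_j ≥ 1` and `i_1 > 1`). -/
noncomputable def multiZeta {d : ℕ} (i : Fin d → ℕ) : ℝ :=
  ∑' n : {n : Fin d → ℕ // StrictAnti n ∧ ∀ j, 1 ≤ n j}, 1 / ∏ j, (n.1 j : ℝ) ^ i j

/-- The polynomial `P_k` in the variables `y_1, …, y_k` (with `y_i = X i`) expressing the `k`-th
elementary symmetric function through the power sums, `e_k = P_k(p_1, …, p_k)`: see
`aeval_psum_elemPoly`. It is given by `P_0 = 1` and
`(k + 1) P_{k+1} = ∑_{i=0}^{k} (-1)^i P_{k-i} y_{i+1}`, so that `P_1 = y_1`,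
`P_2 = (y_1 ^ 2 - y_2) / 2`, `P_3 = (y_1 ^ 3 - 3 y_1 y_2 + 2 y_3) / 6`, … -/
noncomputable def elemPoly : ℕ → MvPolynomial ℕ ℚ
  | 0 => 1
  | k + 1 => MvPolynomial.C (1 / ((k : ℚ) + 1)) *
      ∑ i : Fin (k + 1), (-1) ^ (i : ℕ) * elemPoly (k - i) * MvPolynomial.X ((i : ℕ) + 1)

/-- The defining property of `P_k`: in any finite number of variables, substituting the power sums
`p_i` for the `y_i` gives the elementary symmetric polynomial `e_k`. -/
theorem aeval_psum_elemPoly (σ : Type*) [Fintype σ] (k : ℕ) :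
    MvPolynomial.aeval (fun i : ℕ => MvPolynomial.psum σ ℚ i) (elemPoly k) =
      MvPolynomial.esymm σ ℚ k := by
  induction k using Nat.strong_induction_on with
  | _ k ih =>
    cases k with
    | zero => simp [elemPoly]
    | succ k =>
      have hN := MvPolynomial.mul_esymm_eq_sum σ ℚ (k + 1)
      have hk : ((k : ℚ) + 1) ≠ 0 := by positivity
      have hs : ∑ i : Fin (k + 1), (-1 : MvPolynomial σ ℚ) ^ (i : ℕ) *
            MvPolynomial.esymm σ ℚ (k - i) * MvPolynomial.psum σ ℚ ((i : ℕ) + 1) =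
          ((k + 1 : ℕ) : MvPolynomial σ ℚ) * MvPolynomial.esymm σ ℚ (k + 1) := by
        rw [hN, Finset.mul_sum]
        refine Finset.sum_bij' (fun i _ => (k - (i : ℕ), (i : ℕ) + 1))
          (fun a ha => ⟨a.2 - 1, by
            simp only [Finset.mem_filter, Finset.HasAntidiagonal.mem_antidiagonal] at ha; omega⟩) ?_ ?_ ?_ ?_ ?_
        · intro i _
          have := i.2
          simp only [Finset.mem_filter, Finset.HasAntidiagonal.mem_antidiagonal]
          omega
        · intro a _
          exact Finset.mem_univ _
        · intro i _
          simp
        · rintro ⟨a, b⟩ ha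
          simp only [Finset.mem_filter, Finset.HasAntidiagonal.mem_antidiagonal] at ha
          ext <;> simp <;> omega
        · intro i _
          have hi : (i : ℕ) ≤ k := Nat.lt_succ_iff.mp i.2
          have h2 : (-1 : MvPolynomial σ ℚ) ^ (k + 1 + 1) * (-1) ^ (k - (i : ℕ)) =
              (-1) ^ (i : ℕ) := by
            rw [← pow_add, show k + 1 + 1 + (k - (i : ℕ)) = i + 2 * (k - i + 1) by omega,
              pow_add, pow_mul]
            simp
          simp only [← h2]
          ring
      rw [elemPoly, map_mul, map_sum, MvPolynomial.aeval_C]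
      have h3 : ∀ i : Fin (k + 1), MvPolynomial.aeval (fun i : ℕ => MvPolynomial.psum σ ℚ i)
            ((-1) ^ (i : ℕ) * elemPoly (k - i) * MvPolynomial.X ((i : ℕ) + 1)) =
          (-1 : MvPolynomial σ ℚ) ^ (i : ℕ) *
            MvPolynomial.esymm σ ℚ (k - i) * MvPolynomial.psum σ ℚ ((i : ℕ) + 1) := by
        intro i
        rw [map_mul, map_mul, ih (k - i) (by omega), MvPolynomial.aeval_X]
        simp
      simp only [h3]
      rw [hs, ← mul_assoc, MvPolynomial.algebraMap_eq,
        show ((k + 1 : ℕ) : MvPolynomial σ ℚ) = MvPolynomial.C ((k : ℚ) + 1) by simp,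
        ← MvPolynomial.C_mul, one_div, inv_mul_cancel₀ hk, MvPolynomial.C_1, one_mul]

/-- `P_k(H_n, H_n^{(2)}, …, H_n^{(k)})`. -/
noncomputable def elemPolyHarmonic (k n : ℕ) : ℝ :=
  MvPolynomial.aeval (fun i : ℕ => genHarmonic i n) (elemPoly k)

open Filter Topology PowerSeries
open scoped PowerSeries.WithPiTopology

/-! ### Elementary symmetric functions of `1, 1/2, …, 1/n` -/

/-! This is the connected sum method, with a formal variable `X` carrying a generating function. By
Newton's identities `elemPolyHarmonic k n` is `e_k(1, 1/2, …, 1/n)`. The connector `c(a, m) = a! /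
((m+1-X)⋯(m+a-X))` telescopes in `a` and in `m`, which gives `∑_n e_k(n)/(n+1) · c(n+1, m+1) =
(m+1-X)^{-(k+1)}` (`hasSum_elemPolyHarmonic_connector`) and `∑_m c(n+1, m+1)/(m+1-X) = c(n+1,
0)/(n+1)` (`hasSum_connector_right`). Evaluating one double sum in both orders yields `∑_n
e_k(n)/(n+1)^2 · c(n+1, 0) = ∑_m (m+1-X)^{-(k+2)}`. A further factor `∑_{l<m} 1/(l+1-X)` on the
right replaces the square by a cube.

Since `c(n, 0) = ∏_{j≤n} (1 - X/j)^{-1}`, its coefficients are the complete symmetric functions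
`h_d(1, …, 1/n)`, with `h_1 = H_n` and `h_2 = (H_n^2 + H_n^{(2)})/2`. Low coefficients of the two
identities evaluate sums containing `h_d` at `n+1`; the recurrence `h_d(n+1) = h_d(n) +
h_{d-1}(n+1)/(n+1)` brings them back to `n`. All coefficients are nonnegative, so every exchange of
sums is Tonelli applied to each coefficient. -/

theorem genHarmonic_zero (r : ℕ) : genHarmonic r 0 = 0 := by
  simp [genHarmonic]

theorem genHarmonic_succ (r n : ℕ) :
    genHarmonic r (n + 1) = genHarmonic r n + 1 / ((n : ℝ) + 1) ^ r := by
  simp [genHarmonic, Finset.sum_Icc_succ_top]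

theorem genHarmonic_eq_sum_range (r n : ℕ) :
    genHarmonic r n = ∑ l ∈ Finset.range n, 1 / ((l : ℝ) + 1) ^ r := by
  induction n with
  | zero => simp [genHarmonic]
  | succ n ih => rw [genHarmonic_succ, ih, Finset.sum_range_succ]

theorem genHarmonic_nonneg (r n : ℕ) : 0 ≤ genHarmonic r n :=
  Finset.sum_nonneg fun _ _ => by positivity

theorem genHarmonic_le (r n : ℕ) : genHarmonic r n ≤ n := by
  induction n with
  | zero => simp [genHarmonic]
  | succ n ih =>
    rw [genHarmonic_succ]
    have h : 1 / ((n : ℝ) + 1) ^ r ≤ 1 := by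
      rw [div_le_one (by positivity)]
      exact one_le_pow₀ (by linarith [Nat.cast_nonneg (α := ℝ) n])
    push_cast
    linarith

theorem Multiset.esymm_succ_cons {R : Type*} [CommSemiring R] (k : ℕ) (a : R) (s : Multiset R) :
    (a ::ₘ s).esymm (k + 1) = s.esymm (k + 1) + a * s.esymm k := by
  simp only [Multiset.esymm, Multiset.powersetCard_cons, Multiset.map_add, Multiset.sum_add,
    Multiset.map_map, Function.comp_def, Multiset.prod_cons, Multiset.sum_map_mul_left]

theorem elemPolyHarmonic_eq_esymm (k n : ℕ) :
    elemPolyHarmonic k n =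
      ((Multiset.range n).map fun j : ℕ => 1 / ((j : ℝ) + 1)).esymm k := by
  have h := congrArg (MvPolynomial.aeval fun j : Fin n => 1 / ((j : ℝ) + 1))
    (aeval_psum_elemPoly (Fin n) k)
  rw [MvPolynomial.comp_aeval_apply, MvPolynomial.aeval_esymm_eq_multiset_esymm] at h
  have hp : (fun i : ℕ => MvPolynomial.aeval (fun j : Fin n => 1 / ((j : ℝ) + 1))
      (MvPolynomial.psum (Fin n) ℚ i)) = fun i => genHarmonic i n := by
    funext i
    simp only [MvPolynomial.psum, map_sum, map_pow, MvPolynomial.aeval_X]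
    rw [Fin.sum_univ_eq_sum_range (fun j : ℕ => (1 / ((j : ℝ) + 1)) ^ i) n,
      genHarmonic_eq_sum_range]
    simp
  rw [hp] at h
  rw [elemPolyHarmonic, h]
  congr 1
  rw [Fin.univ_val_map, List.ofFn_eq_map, ← Multiset.coe_range, Multiset.map_coe,
    ← List.map_coe_finRange_eq_range, List.map_map]
  rfl

theorem elemPolyHarmonic_zero (n : ℕ) : elemPolyHarmonic 0 n = 1 := by
  simp [elemPolyHarmonic, elemPoly]

/-- The products in `e_{k+1}` are grouped by their largest denominator `i + 1`. -/
theorem elemPolyHarmonic_succ (k n : ℕ) :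
    elemPolyHarmonic (k + 1) n =
      ∑ i ∈ Finset.range n, elemPolyHarmonic k i / ((i : ℝ) + 1) := by
  induction n with
  | zero => simp [elemPolyHarmonic_eq_esymm, Multiset.esymm, Multiset.powersetCard_zero_right]
  | succ n ih =>
    rw [Finset.sum_range_succ, ← ih]
    simp only [elemPolyHarmonic_eq_esymm, Multiset.range_succ, Multiset.map_cons,
      Multiset.esymm_succ_cons]
    ring

theorem elemPolyHarmonic_nonneg (k n : ℕ) : 0 ≤ elemPolyHarmonic k n := by
  induction k generalizing n with
  | zero => simp [elemPolyHarmonic_zero]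
  | succ k ih =>
    rw [elemPolyHarmonic_succ]
    exact Finset.sum_nonneg fun i _ => div_nonneg (ih i) (by positivity)

/-! ### Double sums with nonnegative terms -/

theorem HasSum.exchange_of_nonneg {f : ℕ → ℕ → ℝ} (hf : ∀ n m, 0 ≤ f n m) {g h : ℕ → ℝ} {S : ℝ}
    (hg : ∀ n, HasSum (f n) (g n)) (hh : ∀ m, HasSum (fun n => f n m) (h m))
    (hS : HasSum g S) : HasSum h S := by
  have hs : Summable fun p : ℕ × ℕ => f p.1 p.2 := by
    rw [summable_prod_of_nonneg fun p => hf p.1 p.2]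
    refine ⟨fun n => (hg n).summable, ?_⟩
    simpa only [(hg _).tsum_eq] using hS.summable
  have hs' := hs.hasSum
  rw [(hs'.prod_fiberwise hg).unique hS] at hs'
  exact ((Equiv.prodComm ℕ ℕ).hasSum_iff.mpr hs').prod_fiberwise hh

/-- All coefficients of the power series are nonnegative. -/
def NonnegCoeff (p : ℝ⟦X⟧) : Prop := ∀ d, 0 ≤ coeff d p

theorem NonnegCoeff.mul {p q : ℝ⟦X⟧} (hp : NonnegCoeff p) (hq : NonnegCoeff q) :
    NonnegCoeff (p * q) := fun d => by
  rw [coeff_mul]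
  exact Finset.sum_nonneg fun x _ => mul_nonneg (hp _) (hq _)

theorem NonnegCoeff.zero : NonnegCoeff 0 := fun d => by simp

theorem NonnegCoeff.C {r : ℝ} (hr : 0 ≤ r) : NonnegCoeff (C r) := fun d => by
  rw [coeff_C]; split_ifs <;> simp [hr]

theorem NonnegCoeff.sum {ι : Type*} {s : Finset ι} {p : ι → ℝ⟦X⟧} (hp : ∀ i, NonnegCoeff (p i)) :
    NonnegCoeff (∑ i ∈ s, p i) := fun d => by
  rw [map_sum]
  exact Finset.sum_nonneg fun i _ => hp i d

theorem NonnegCoeff.prod {ι : Type*} {s : Finset ι} {p : ι → ℝ⟦X⟧}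
    (hp : ∀ i, NonnegCoeff (p i)) : NonnegCoeff (∏ i ∈ s, p i) :=
  Finset.prod_induction _ _ (fun _ _ => NonnegCoeff.mul)
    (by simpa using NonnegCoeff.C zero_le_one) fun i _ => hp i

theorem NonnegCoeff.exchange {f : ℕ → ℕ → ℝ⟦X⟧} (hf : ∀ n m, NonnegCoeff (f n m))
    {g h : ℕ → ℝ⟦X⟧} {S : ℝ⟦X⟧} (hg : ∀ n, HasSum (f n) (g n))
    (hh : ∀ m, HasSum (fun n => f n m) (h m)) (hS : HasSum g S) : HasSum h S := by
  simp only [WithPiTopology.hasSum_iff_hasSum_coeff] at *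
  exact fun d => HasSum.exchange_of_nonneg (fun n m => hf n m d) (fun n => hg n d)
    (fun m => hh m d) (hS d)

/-- Nonnegativity upgrades convergence of the partial sums to unconditional summability, one
coefficient at a time. -/
theorem hasSum_telescope {f u : ℕ → ℝ⟦X⟧} (hf : ∀ n, NonnegCoeff (f n))
    (hu : ∀ n, f n = u n - u (n + 1)) (hlim : Tendsto u atTop (𝓝 0)) : HasSum f (u 0) := by
  rw [WithPiTopology.hasSum_iff_hasSum_coeff]
  intro d
  rw [hasSum_iff_tendsto_nat_of_nonneg fun n => hf n d]
  have hl := (WithPiTopology.tendsto_iff_coeff_tendsto _ _ _ _).mp hlim d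
  have hs : ∀ n, ∑ i ∈ Finset.range n, coeff d (f i) = coeff d (u 0) - coeff d (u n) := fun n => by
    rw [← Finset.sum_range_sub' fun n => coeff d (u n)]
    exact Finset.sum_congr rfl fun i _ => by rw [hu, map_sub]
  simp only [hs]
  simpa using hl.const_sub (coeff d (u 0))

/-! ### The connector -/

/-- The expansion of `1 / (s + 1 - X)`. -/
noncomputable def shiftInv (s : ℕ) : ℝ⟦X⟧ := PowerSeries.mk fun j => (1 / ((s : ℝ) + 1)) ^ (j + 1)

theorem shiftInv_nonneg (s : ℕ) : NonnegCoeff (shiftInv s) := fun d => by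
  rw [shiftInv, coeff_mk]; positivity

theorem shiftInv_mul (s : ℕ) : shiftInv s * ((s : ℝ⟦X⟧) + 1 - X) = 1 := by
  have hs : ((s : ℝ) + 1) ≠ 0 := by positivity
  have hc : ((s : ℝ⟦X⟧) + 1) = C ((s : ℝ) + 1) := by simp
  ext d
  rw [mul_sub, map_sub, hc, coeff_mul_C, coeff_one]
  cases d with
  | zero => simp [shiftInv, hs]
  | succ d =>
    rw [coeff_succ_mul_X]
    simp only [shiftInv, coeff_mk, Nat.succ_ne_zero, if_false]
    rw [pow_succ _ (d + 1), mul_assoc, one_div_mul_cancel hs, mul_one, sub_self]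

theorem coeff_shiftInv_pow (s k d : ℕ) :
    coeff d (shiftInv s ^ (k + 1)) = ((k + d).choose k : ℝ) / ((s : ℝ) + 1) ^ (k + 1 + d) := by
  have h : shiftInv s = C (1 / ((s : ℝ) + 1)) * rescale (1 / ((s : ℝ) + 1)) (PowerSeries.mk 1) := by
    ext j
    simp [shiftInv, pow_succ']
  rw [h, mul_pow, ← map_pow, ← map_pow, mk_one_pow_eq_mk_choose_add, coeff_C_mul, coeff_rescale,
    coeff_mk, ← mul_assoc, ← pow_add, one_div_pow, mul_comm, mul_one_div]

theorem tendsto_shiftInv : Tendsto shiftInv atTop (𝓝 0) := by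
  rw [WithPiTopology.tendsto_iff_coeff_tendsto]
  intro d
  simpa [shiftInv] using (tendsto_one_div_add_atTop_nhds_zero_nat (𝕜 := ℝ)).pow (d + 1)

/-- The connector `a! / ((m + 1 - X) ⋯ (m + a - X))`. -/
noncomputable def connector (a m : ℕ) : ℝ⟦X⟧ :=
  ∏ i ∈ Finset.range a, ((i : ℝ⟦X⟧) + 1) * shiftInv (m + i)

theorem connector_zero (m : ℕ) : connector 0 m = 1 := by simp [connector]

theorem connector_succ (a m : ℕ) :
    connector (a + 1) m = connector a m * (((a : ℝ⟦X⟧) + 1) * shiftInv (m + a)) :=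
  Finset.prod_range_succ _ _

theorem connector_nonneg (a m : ℕ) : NonnegCoeff (connector a m) :=
  NonnegCoeff.prod fun i => by
    have h : ((i : ℝ⟦X⟧) + 1) = C ((i : ℝ) + 1) := by simp
    rw [h]
    exact (NonnegCoeff.C (by positivity)).mul (shiftInv_nonneg _)

/-- Both sides equal `a! · ∏_{i=0}^{a} shiftInv (m + i)`. -/
theorem connector_mul_shiftInv (a m : ℕ) :
    connector a (m + 1) * shiftInv m = connector a m * shiftInv (m + a) := by
  induction a with
  | zero => simp [connector]
  | succ a ih =>
    rw [connector_succ, connector_succ, show m + 1 + a = m + (a + 1) by ring]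
    linear_combination (((a : ℝ⟦X⟧) + 1) * shiftInv (m + (a + 1))) * ih

/-- Over a common denominator this is `(m + a + 1 - X) - (m + 1 - X) = a`. -/
theorem connector_sub_right (a m : ℕ) :
    (a : ℝ⟦X⟧) * (shiftInv m * connector a (m + 1)) = connector a m - connector a (m + 1) := by
  have h1 := connector_mul_shiftInv a m
  have h2 := shiftInv_mul m
  have h3 := shiftInv_mul (m + a)
  push_cast at h3
  linear_combination ((a : ℝ⟦X⟧) + m + 1 - X) * h1 + (-connector a (m + 1)) * h2 +
    connector a m * h3

theorem connector_sub_left (a m : ℕ) :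
    connector (a + 1) (m + 1) =
      ((a : ℝ⟦X⟧) + 1) * (shiftInv m * (connector a (m + 1) - connector (a + 1) (m + 1))) := by
  rw [connector_succ]
  have h2 := shiftInv_mul m
  have h3 := shiftInv_mul (m + 1 + a)
  push_cast at h3
  linear_combination (((a : ℝ⟦X⟧) + 1) * shiftInv m * connector a (m + 1)) * h3 -
    (((a : ℝ⟦X⟧) + 1) * shiftInv (m + 1 + a) * connector a (m + 1)) * h2

theorem tendsto_connector_right (a : ℕ) :
    Tendsto (fun m => connector (a + 1) m) atTop (𝓝 0) := by
  have h := tendsto_finsetProd (Finset.range (a + 1))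
    (f := fun (i m : ℕ) => ((i : ℝ⟦X⟧) + 1) * shiftInv (m + i)) (a := fun _ => 0) (x := atTop) ?_
  · simpa [connector] using h
  · intro i _
    simpa using ((tendsto_shiftInv.comp (tendsto_add_atTop_nat i)).const_mul ((i : ℝ⟦X⟧) + 1))

/-- Clearing the last denominator makes the coefficients obey a two-term recurrence in `a`. -/
theorem connector_succ_mul (a m : ℕ) :
    connector (a + 1) m * (C ((m : ℝ) + a + 1) - X) = C ((a : ℝ) + 1) * connector a m := by
  have h := shiftInv_mul (m + a)
  push_cast at h
  rw [connector_succ]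
  simp only [map_add, map_one, map_natCast]
  linear_combination (((a : ℝ⟦X⟧) + 1) * connector a m) * h

theorem coeff_zero_connector_succ (a m : ℕ) :
    ((m : ℝ) + a + 1) * coeff 0 (connector (a + 1) m) = (a + 1) * coeff 0 (connector a m) := by
  have h := congrArg (coeff 0) (connector_succ_mul a m)
  rw [mul_sub, map_sub, coeff_mul_C, coeff_C_mul, coeff_zero_mul_X] at h
  linarith

theorem coeff_succ_connector_succ (d a m : ℕ) :
    ((m : ℝ) + a + 1) * coeff (d + 1) (connector (a + 1) m) =
      (a + 1) * coeff (d + 1) (connector a m) + coeff d (connector (a + 1) m) := by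
  have h := congrArg (coeff (d + 1)) (connector_succ_mul a m)
  rw [mul_sub, map_sub, coeff_mul_C, coeff_C_mul, coeff_succ_mul_X] at h
  linarith

/-- At `m = 0` the connector is `(a+1)^{-1} ∏_{j=2}^{a+1} (1 - X/j)^{-1}`, and `h_d` is at most the
`d`-th power of the sum of its variables. The shift to `m + 1` is essential: `connector a 0` has
constant term 1 and does not tend to 0. -/
theorem coeff_connector_le (d a m : ℕ) :
    coeff d (connector a (m + 1)) ≤ genHarmonic 1 a ^ d / ((a : ℝ) + 1) := by
  have hm : (0 : ℝ) ≤ m := Nat.cast_nonneg m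
  induction d generalizing a with
  | zero =>
    induction a with
    | zero => simp [connector]
    | succ a iha =>
      have h := coeff_zero_connector_succ a (m + 1)
      have ha : (0 : ℝ) < (a : ℝ) + 1 := by positivity
      have h0 := connector_nonneg (a + 1) (m + 1) 0
      rw [pow_zero, le_div_iff₀ ha] at iha
      push_cast at h ⊢
      rw [pow_zero, le_div_iff₀ (by linarith)]
      nlinarith
  | succ d ihd =>
    induction a with
    | zero => simp [connector, genHarmonic, coeff_one]
    | succ a iha =>
      have h := coeff_succ_connector_succ d a (m + 1)
      have ha : (0 : ℝ) < (a : ℝ) + 1 := by positivity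
      have h0 := connector_nonneg (a + 1) (m + 1) (d + 1)
      have hH := genHarmonic_nonneg 1 a
      have hH' : genHarmonic 1 (a + 1) * (a + 1) = genHarmonic 1 a * (a + 1) + 1 := by
        rw [genHarmonic_succ]; field_simp
      have hle : genHarmonic 1 a ≤ genHarmonic 1 (a + 1) := by
        rw [genHarmonic_succ]; linarith [show (0 : ℝ) ≤ 1 / ((a : ℝ) + 1) ^ 1 by positivity]
      have hd := ihd (a + 1)
      have hpow : genHarmonic 1 a ^ d ≤ genHarmonic 1 (a + 1) ^ d := pow_le_pow_left₀ hH hle d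
      have hp0 : 0 ≤ genHarmonic 1 (a + 1) ^ d := pow_nonneg (genHarmonic_nonneg _ _) d
      rw [le_div_iff₀ ha] at iha
      push_cast at h hd ⊢
      rw [le_div_iff₀ (by linarith)] at hd ⊢
      set H := genHarmonic 1 a
      set H' := genHarmonic 1 (a + 1)
      set u := coeff (d + 1) (connector (a + 1) (m + 1))
      set v := coeff d (connector (a + 1) (m + 1))
      have h1 : u * ((a : ℝ) + 1 + 1) ≤ H ^ (d + 1) + v := by nlinarith
      have h2 : v * ((a : ℝ) + 1) ≤ H' ^ d := by
        have := connector_nonneg (a + 1) (m + 1) d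
        nlinarith
      have h3 : H ^ (d + 1) ≤ H' ^ d * H := by
        rw [pow_succ]; exact mul_le_mul_of_nonneg_right hpow hH
      rw [pow_succ H' d]
      refine le_of_mul_le_mul_right ?_ ha
      calc u * ((a : ℝ) + 1 + 1) * (a + 1) ≤ (H ^ (d + 1) + v) * (a + 1) :=
            mul_le_mul_of_nonneg_right h1 ha.le
        _ = H ^ (d + 1) * (a + 1) + v * (a + 1) := by ring
        _ ≤ H' ^ d * H * (a + 1) + H' ^ d := add_le_add (mul_le_mul_of_nonneg_right h3 ha.le) h2
        _ = H' ^ d * (H' * (a + 1)) := by rw [hH']; ring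
        _ = H' ^ d * H' * (a + 1) := by ring

theorem genHarmonic_one_eq_harmonic (n : ℕ) : genHarmonic 1 n = harmonic n := by
  simp [genHarmonic_eq_sum_range, harmonic]

theorem tendsto_genHarmonic_pow_div (d : ℕ) :
    Tendsto (fun a : ℕ => genHarmonic 1 a ^ d / ((a : ℝ) + 1)) atTop (𝓝 0) := by
  -- Substituting `x = e * a` absorbs the 1 in `H_a ≤ 1 + log a = log (e * a)`; the factor `exp
  -- (-1)` restores the denominator `a`.
  have h1 := (Real.tendsto_pow_log_div_mul_add_atTop (Real.exp (-1)) 0 d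
    (Real.exp_pos _).ne').comp
      ((tendsto_natCast_atTop_atTop (R := ℝ)).const_mul_atTop (Real.exp_pos 1))
  refine squeeze_zero' (Eventually.of_forall fun a => ?_) ?_ h1
  · exact div_nonneg (pow_nonneg (genHarmonic_nonneg _ _) _) (by positivity)
  · filter_upwards [eventually_ge_atTop 1] with a ha
    have ha' : (0 : ℝ) < a := by exact_mod_cast ha
    have hH : genHarmonic 1 a ≤ Real.log (Real.exp 1 * a) := by
      rw [Real.log_mul (Real.exp_pos 1).ne' ha'.ne', Real.log_exp, genHarmonic_one_eq_harmonic]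
      exact harmonic_le_one_add_log a
    simp only [Function.comp_apply, add_zero, ← mul_assoc, ← Real.exp_add, neg_add_cancel,
      Real.exp_zero, one_mul]
    have := genHarmonic_nonneg 1 a
    exact div_le_div₀ (pow_nonneg (this.trans hH) d) (pow_le_pow_left₀ this hH d) ha'
      (by linarith)

theorem tendsto_connector_left (m : ℕ) :
    Tendsto (fun a => connector a (m + 1)) atTop (𝓝 0) := by
  rw [WithPiTopology.tendsto_iff_coeff_tendsto]
  intro d
  rw [map_zero]
  exact squeeze_zero (fun a => connector_nonneg a (m + 1) d)
    (fun a => coeff_connector_le d a m) (tendsto_genHarmonic_pow_div d)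

/-! ### Sums of connectors -/

theorem HasSum.of_eq {ι α : Type*} [AddCommMonoid α] [TopologicalSpace α] {f g : ι → α} {a b : α}
    (h : HasSum f a) (hfg : ∀ i, g i = f i) (hab : b = a) : HasSum g b := by
  rwa [funext hfg, hab]

theorem hasSum_connector_left (N m : ℕ) :
    HasSum (fun n => if N ≤ n then C (1 / ((n : ℝ) + 1)) * connector (n + 1) (m + 1) else 0)
      (shiftInv m * connector N (m + 1)) := by
  have h := hasSum_telescope
    (f := fun n => if N ≤ n then C (1 / ((n : ℝ) + 1)) * connector (n + 1) (m + 1) else 0)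
    -- The `max` keeps `u` constant up to `N`, so the terms below the cutoff vanish.
    (u := fun n => shiftInv m * connector (max n N) (m + 1)) (fun n => ?_) (fun n => ?_) ?_
  · simpa using h
  · split_ifs
    · exact (NonnegCoeff.C (by positivity)).mul (connector_nonneg _ _)
    · exact NonnegCoeff.zero
  · split_ifs with hn
    · rw [max_eq_left hn, max_eq_left (by omega)]
      have h1 : (C (1 / ((n : ℝ) + 1)) : ℝ⟦X⟧) * ((n : ℝ⟦X⟧) + 1) = 1 := by
        rw [show ((n : ℝ⟦X⟧) + 1) = C ((n : ℝ) + 1) by simp, ← map_mul,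
          one_div_mul_cancel (by positivity), map_one]
      have h2 := connector_sub_left n m
      linear_combination (C (1 / ((n : ℝ) + 1)) : ℝ⟦X⟧) * h2 +
        shiftInv m * (connector n (m + 1) - connector (n + 1) (m + 1)) * h1
    · rw [max_eq_right (by omega), max_eq_right (by omega), sub_self]
  · have h := (tendsto_connector_left m).const_mul (shiftInv m)
    rw [mul_zero] at h
    exact h.comp (tendsto_atTop_mono (fun n => le_max_left n N) tendsto_id)

theorem hasSum_connector_right (a l : ℕ) :
    HasSum (fun m => if l ≤ m then shiftInv m * connector (a + 1) (m + 1) else 0)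
      (C (1 / ((a : ℝ) + 1)) * connector (a + 1) l) := by
  have h := hasSum_telescope
    (f := fun m => if l ≤ m then shiftInv m * connector (a + 1) (m + 1) else 0)
    (u := fun m => C (1 / ((a : ℝ) + 1)) * connector (a + 1) (max m l))
    (fun m => ?_) (fun m => ?_) ?_
  · simpa using h
  · split_ifs
    · exact (shiftInv_nonneg _).mul (connector_nonneg _ _)
    · exact NonnegCoeff.zero
  · split_ifs with hm
    · rw [max_eq_left hm, max_eq_left (by omega)]
      have h1 : (C (1 / ((a : ℝ) + 1)) : ℝ⟦X⟧) * ((a : ℝ⟦X⟧) + 1) = 1 := by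
        rw [show ((a : ℝ⟦X⟧) + 1) = C ((a : ℝ) + 1) by simp, ← map_mul,
          one_div_mul_cancel (by positivity), map_one]
      have h2 := connector_sub_right (a + 1) m
      push_cast at h2
      linear_combination (C (1 / ((a : ℝ) + 1)) : ℝ⟦X⟧) * h2 -
        shiftInv m * connector (a + 1) (m + 1) * h1
    · rw [max_eq_right (by omega), max_eq_right (by omega), sub_self]
  · have h := (tendsto_connector_right a).const_mul (C (1 / ((a : ℝ) + 1)))
    rw [mul_zero] at h
    exact h.comp (tendsto_atTop_mono (fun m => le_max_left m l) tendsto_id)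

theorem elemPolyHarmonic_div_nonneg (k n : ℕ) : 0 ≤ elemPolyHarmonic k n / ((n : ℝ) + 1) :=
  div_nonneg (elemPolyHarmonic_nonneg k n) (by positivity)

theorem hasSum_elemPolyHarmonic_connector (k m : ℕ) :
    HasSum (fun n => C (elemPolyHarmonic k n / ((n : ℝ) + 1)) * connector (n + 1) (m + 1))
      (shiftInv m ^ (k + 1)) := by
  induction k with
  | zero => simpa [elemPolyHarmonic_zero, connector_zero] using hasSum_connector_left 0 m
  | succ k ih =>
    -- One factor `shiftInv m` is traded for a tail sum over `n > i`; after the exchange, the inner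
    -- sum over `i < n` assembles `e_{k+1}`.
    refine NonnegCoeff.exchange
      (f := fun i n => C (elemPolyHarmonic k i / ((i : ℝ) + 1)) *
        if i + 1 ≤ n then C (1 / ((n : ℝ) + 1)) * connector (n + 1) (m + 1) else 0)
      (fun i n => (NonnegCoeff.C (elemPolyHarmonic_div_nonneg k i)).mul ?_)
      (fun i => (hasSum_connector_left (i + 1) m).mul_left _) (fun n => ?_) ?_
    · split_ifs
      · exact (NonnegCoeff.C (by positivity)).mul (connector_nonneg _ _)
      · exact NonnegCoeff.zero
    · have h := hasSum_sum_of_ne_finset_zero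
        (f := fun i => C (elemPolyHarmonic k i / ((i : ℝ) + 1)) *
          if i + 1 ≤ n then C (1 / ((n : ℝ) + 1)) * connector (n + 1) (m + 1) else 0)
        (s := Finset.range n) (L := SummationFilter.unconditional ℕ) (fun i hi => by
          rw [if_neg (by simpa using hi), mul_zero])
      convert h using 1
      rw [Finset.sum_congr rfl fun i hi => by
        rw [if_pos (Nat.succ_le_of_lt (Finset.mem_range.mp hi))], ← Finset.sum_mul, ← map_sum,
        ← elemPolyHarmonic_succ, ← mul_assoc, ← map_mul, mul_one_div]
    · exact (ih.mul_left (shiftInv m)).of_eq (fun i => by ring) (by ring)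

/-- Two telescopings in the second argument, over `m > l` and then over `l`, each contribute a
factor `1 / (a + 1)`. -/
theorem hasSum_connector_sum_shiftInv (a : ℕ) :
    HasSum (fun m => shiftInv m * (∑ l ∈ Finset.range m, shiftInv l) * connector (a + 1) (m + 1))
      (C (1 / ((a : ℝ) + 1) ^ 2) * connector (a + 1) 0) := by
  have h0 := (hasSum_connector_right a 0).mul_left (C (1 / ((a : ℝ) + 1)))
  simp only [Nat.zero_le, if_true] at h0
  rw [← mul_assoc, ← map_mul, ← pow_two, one_div_pow] at h0
  refine NonnegCoeff.exchange
    (f := fun l m => shiftInv l *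
      if l + 1 ≤ m then shiftInv m * connector (a + 1) (m + 1) else 0)
    (fun l m => (shiftInv_nonneg l).mul ?_)
    (fun l => (hasSum_connector_right a (l + 1)).mul_left _) (fun m => ?_) ?_
  · split_ifs
    · exact (shiftInv_nonneg _).mul (connector_nonneg _ _)
    · exact NonnegCoeff.zero
  · have h := hasSum_sum_of_ne_finset_zero
      (f := fun l => shiftInv l *
        if l + 1 ≤ m then shiftInv m * connector (a + 1) (m + 1) else 0)
      (s := Finset.range m) (L := SummationFilter.unconditional ℕ) (fun i hi => by
        rw [if_neg (by simpa using hi), mul_zero])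
    refine h.of_eq (fun _ => rfl) ?_
    have hc : ∀ l ∈ Finset.range m, (shiftInv l *
        if l + 1 ≤ m then shiftInv m * connector (a + 1) (m + 1) else 0) =
          shiftInv l * (shiftInv m * connector (a + 1) (m + 1)) := fun l hl => by
      rw [if_pos (Nat.succ_le_of_lt (Finset.mem_range.mp hl))]
    rw [Finset.sum_congr rfl hc, ← Finset.sum_mul]
    ring
  · exact h0.of_eq (fun l => by ring) rfl

theorem hasSum_coeff_connector_div_sq {k d : ℕ} {S : ℝ}
    (hS : HasSum (fun m => coeff d (shiftInv m ^ (k + 2))) S) :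
    HasSum (fun n : ℕ => elemPolyHarmonic k n / ((n : ℝ) + 1) ^ 2 *
      coeff d (connector (n + 1) 0)) S := by
  refine HasSum.exchange_of_nonneg
    (f := fun m n => coeff d (C (elemPolyHarmonic k n / ((n : ℝ) + 1)) *
      (shiftInv m * connector (n + 1) (m + 1))))
    (fun m n => ((NonnegCoeff.C (elemPolyHarmonic_div_nonneg k n)).mul
      ((shiftInv_nonneg m).mul (connector_nonneg _ _))) d)
    (fun m => ?_) (fun n => ?_) hS
  · refine (WithPiTopology.hasSum_iff_hasSum_coeff ℝ).mp ?_ d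
    exact ((hasSum_elemPolyHarmonic_connector k m).mul_left (shiftInv m)).of_eq
      (fun n => by ring) (by ring)
  · have h := (WithPiTopology.hasSum_iff_hasSum_coeff ℝ).mp ((hasSum_connector_right n 0).mul_left
      (C (elemPolyHarmonic k n / ((n : ℝ) + 1)))) d
    simp only [Nat.zero_le, if_true] at h
    rw [← mul_assoc, ← map_mul, coeff_C_mul] at h
    refine h.of_eq (fun _ => rfl) ?_
    field_simp

theorem hasSum_coeff_connector_div_cube {k d : ℕ} {S : ℝ}
    (hS : HasSum (fun m => coeff d (shiftInv m ^ (k + 2) * ∑ l ∈ Finset.range m, shiftInv l)) S) :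
    HasSum (fun n : ℕ => elemPolyHarmonic k n / ((n : ℝ) + 1) ^ 3 *
      coeff d (connector (n + 1) 0)) S := by
  refine HasSum.exchange_of_nonneg
    (f := fun m n => coeff d (C (elemPolyHarmonic k n / ((n : ℝ) + 1)) *
      (shiftInv m * (∑ l ∈ Finset.range m, shiftInv l) * connector (n + 1) (m + 1))))
    (fun m n => ((NonnegCoeff.C (elemPolyHarmonic_div_nonneg k n)).mul
      (((shiftInv_nonneg m).mul (NonnegCoeff.sum shiftInv_nonneg)).mul (connector_nonneg _ _))) d)
    (fun m => ?_) (fun n => ?_) hS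
  · refine (WithPiTopology.hasSum_iff_hasSum_coeff ℝ).mp ?_ d
    exact ((hasSum_elemPolyHarmonic_connector k m).mul_left
      (shiftInv m * ∑ l ∈ Finset.range m, shiftInv l)).of_eq (fun n => by ring) (by ring)
  · have h := (WithPiTopology.hasSum_iff_hasSum_coeff ℝ).mp ((hasSum_connector_sum_shiftInv n).mul_left
      (C (elemPolyHarmonic k n / ((n : ℝ) + 1)))) d
    rw [← mul_assoc, ← map_mul, coeff_C_mul] at h
    refine h.of_eq (fun _ => rfl) ?_
    field_simp

/-! ### Low order coefficients -/

theorem coeff_shiftInv (s d : ℕ) : coeff d (shiftInv s) = 1 / ((s : ℝ) + 1) ^ (d + 1) := by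
  rw [shiftInv, coeff_mk, one_div_pow]

theorem coeff_sum_shiftInv (m d : ℕ) :
    coeff d (∑ l ∈ Finset.range m, shiftInv l) = genHarmonic (d + 1) m := by
  simp only [map_sum, coeff_shiftInv, genHarmonic_eq_sum_range]

theorem coeff_zero_connector_zero (n : ℕ) : coeff 0 (connector n 0) = 1 := by
  induction n with
  | zero => simp [connector]
  | succ n ih =>
    have h := coeff_zero_connector_succ n 0
    rw [ih] at h
    have : (n : ℝ) + 1 ≠ 0 := by positivity
    simp only [Nat.cast_zero, zero_add] at h
    exact mul_left_cancel₀ this h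

theorem coeff_succ_connector_zero (d n : ℕ) :
    coeff (d + 1) (connector (n + 1) 0) =
      coeff (d + 1) (connector n 0) + coeff d (connector (n + 1) 0) / ((n : ℝ) + 1) := by
  have h := coeff_succ_connector_succ d n 0
  have : (n : ℝ) + 1 ≠ 0 := by positivity
  simp only [Nat.cast_zero, zero_add] at h
  field_simp
  linarith

theorem coeff_one_connector_zero (n : ℕ) : coeff 1 (connector n 0) = genHarmonic 1 n := by
  induction n with
  | zero => simp [connector, genHarmonic, coeff_one]
  | succ n ih =>
    rw [coeff_succ_connector_zero 0, ih, coeff_zero_connector_zero, genHarmonic_succ, pow_one]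

theorem coeff_two_connector_zero (n : ℕ) :
    coeff 2 (connector n 0) = (genHarmonic 1 n ^ 2 + genHarmonic 2 n) / 2 := by
  induction n with
  | zero => simp [connector, genHarmonic, coeff_one]
  | succ n ih =>
    rw [coeff_succ_connector_zero 1, ih, coeff_one_connector_zero, genHarmonic_succ,
      genHarmonic_succ]
    field_simp
    ring

/-! ### Multiple zeta values of depth one and two -/

theorem hasSum_multiZeta_one {a : ℕ} (ha : 2 ≤ a) :
    HasSum (fun m : ℕ => 1 / ((m : ℝ) + 1) ^ a) (multiZeta ![a]) := by
  have hs : Summable (fun m : ℕ => 1 / ((m : ℝ) + 1) ^ a) := by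
    have := (summable_nat_add_iff 1).mpr (Real.summable_one_div_nat_pow.mpr ha)
    simpa using this
  let e : ℕ ≃ {n : Fin 1 → ℕ // StrictAnti n ∧ ∀ j, 1 ≤ n j} :=
    { toFun := fun m => ⟨fun _ => m + 1, Subsingleton.strictAnti _, fun _ => Nat.le_add_left 1 m⟩
      invFun := fun n => n.1 0 - 1
      left_inv := fun m => by simp
      right_inv := fun n => by
        ext j
        have := n.2.2 0
        rw [Subsingleton.elim j 0]
        simp only
        omega }
  convert hs.hasSum using 1
  rw [multiZeta, ← e.tsum_eq]
  simp [e]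

theorem hasSum_multiZeta_two {a b : ℕ} (ha : 3 ≤ a) :
    HasSum (fun m : ℕ => 1 / ((m : ℝ) + 1) ^ a * genHarmonic b m) (multiZeta ![a, b]) := by
  let e : (Σ m : ℕ, Fin m) ≃ {n : Fin 2 → ℕ // StrictAnti n ∧ ∀ j, 1 ≤ n j} :=
    { toFun := fun p => ⟨![p.1 + 1, p.2 + 1], by
        rw [Fin.strictAnti_iff_succ_lt]
        simp, by simp [Fin.forall_fin_two]⟩
      invFun := fun n => ⟨n.1 0 - 1, ⟨n.1 1 - 1, by
        have h0 := n.2.1 (show (0 : Fin 2) < 1 by decide)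
        have h1 := n.2.2 1
        omega⟩⟩
      left_inv := fun p => by simp
      right_inv := fun n => by
        have h0 := n.2.2 0
        have h1 := n.2.2 1
        ext j
        fin_cases j
        · simp only [Fin.zero_eta, Matrix.cons_val_zero]; omega
        · simp only [Fin.mk_one, Matrix.cons_val_one, Matrix.cons_val_fin_one]; omega }
  have hfib : ∀ m : ℕ, HasSum (fun l : Fin m => 1 / (((m : ℝ) + 1) ^ a * ((l : ℝ) + 1) ^ b))
      (1 / ((m : ℝ) + 1) ^ a * genHarmonic b m) := fun m => by
    convert hasSum_fintype _ using 1
    rw [genHarmonic_eq_sum_range, Finset.mul_sum,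
      Fin.sum_univ_eq_sum_range (fun l : ℕ => 1 / (((m : ℝ) + 1) ^ a * ((l : ℝ) + 1) ^ b)) m]
    exact Finset.sum_congr rfl fun l _ => by rw [one_div_mul_one_div]
  have hs : Summable fun p : Σ m : ℕ, Fin m =>
      1 / (((p.1 : ℝ) + 1) ^ a * ((p.2 : ℝ) + 1) ^ b) := by
    rw [summable_sigma_of_nonneg fun p => by positivity]
    refine ⟨fun m => (hfib m).summable, ?_⟩
    simp only [(hfib _).tsum_eq]
    -- The crude bound `genHarmonic b m ≤ m` costs one power of `m + 1`, whence `3 ≤ a`.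
    refine Summable.of_nonneg_of_le
      (fun m => mul_nonneg (by positivity) (genHarmonic_nonneg _ _)) (fun m => ?_)
      (hasSum_multiZeta_one (a := a - 1) (by omega)).summable
    have hm : (0 : ℝ) < (m : ℝ) + 1 := by positivity
    obtain ⟨c, rfl⟩ : ∃ c, a = c + 1 := ⟨a - 1, by omega⟩
    rw [Nat.add_sub_cancel, one_div_mul_eq_div, div_le_div_iff₀ (by positivity) (by positivity),
      one_mul, pow_succ, mul_comm]
    exact mul_le_mul_of_nonneg_left (by linarith [genHarmonic_le b m]) (by positivity)
  have h := hs.hasSum.sigma hfib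
  convert h using 1
  rw [multiZeta, ← e.tsum_eq]
  simp [e, Fin.prod_univ_two]

/-! ### The main theorem -/

theorem hasSum_elemPolyHarmonic_genHarmonic_succ (k : ℕ) :
    HasSum (fun n : ℕ => elemPolyHarmonic k n / ((n : ℝ) + 1) ^ 2 * genHarmonic 1 (n + 1))
      (((k : ℝ) + 2) * multiZeta ![k + 3]) := by
  have h := hasSum_coeff_connector_div_sq (k := k) (d := 1)
    (S := ((k : ℝ) + 2) * multiZeta ![k + 3]) ?_
  · simpa only [coeff_one_connector_zero] using h
  · refine ((hasSum_multiZeta_one (a := k + 3) (by omega)).mul_left ((k : ℝ) + 2)).of_eq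
      (fun m => ?_) rfl
    rw [coeff_shiftInv_pow, Nat.choose_succ_self_right]
    push_cast
    ring

theorem hasSum_elemPolyHarmonic_complete_succ (k : ℕ) :
    HasSum (fun n : ℕ => elemPolyHarmonic k n / ((n : ℝ) + 1) ^ 2 *
        ((genHarmonic 1 (n + 1) ^ 2 + genHarmonic 2 (n + 1)) / 2))
      (((k + 3).choose 2 : ℝ) * multiZeta ![k + 4]) := by
  have h := hasSum_coeff_connector_div_sq (k := k) (d := 2)
    (S := ((k + 3).choose 2 : ℝ) * multiZeta ![k + 4]) ?_
  · simpa only [coeff_two_connector_zero] using h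
  · refine ((hasSum_multiZeta_one (a := k + 4) (by omega)).mul_left
      ((k + 3).choose 2 : ℝ)).of_eq (fun m => ?_) rfl
    rw [coeff_shiftInv_pow, Nat.choose_symm_add, mul_one_div]

theorem hasSum_elemPolyHarmonic_div_cube {k : ℕ} (hk : 1 ≤ k) :
    HasSum (fun n : ℕ => elemPolyHarmonic k n / ((n : ℝ) + 1) ^ 3) (multiZeta ![k + 2, 1]) := by
  have h := hasSum_coeff_connector_div_cube (k := k) (d := 0) (S := multiZeta ![k + 2, 1]) ?_
  · simpa only [coeff_zero_connector_zero, mul_one] using h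
  · convert hasSum_multiZeta_two (a := k + 2) (b := 1) (by omega) using 1
    funext m
    rw [coeff_mul, Finset.Nat.antidiagonal_zero, Finset.sum_singleton, coeff_sum_shiftInv,
      coeff_shiftInv_pow]
    simp

theorem hasSum_elemPolyHarmonic_genHarmonic_succ_div_cube {k : ℕ} (hk : 1 ≤ k) :
    HasSum (fun n : ℕ => elemPolyHarmonic k n / ((n : ℝ) + 1) ^ 3 * genHarmonic 1 (n + 1))
      (multiZeta ![k + 2, 2] + ((k : ℝ) + 2) * multiZeta ![k + 3, 1]) := by
  have h := hasSum_coeff_connector_div_cube (k := k) (d := 1)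
    (S := multiZeta ![k + 2, 2] + ((k : ℝ) + 2) * multiZeta ![k + 3, 1]) ?_
  · simpa only [coeff_one_connector_zero] using h
  · refine ((hasSum_multiZeta_two (a := k + 2) (b := 2) (by omega)).add
      ((hasSum_multiZeta_two (a := k + 3) (b := 1) (by omega)).mul_left ((k : ℝ) + 2))).of_eq
      (fun m => ?_) rfl
    -- The degree-one coefficient of the product has two terms, one for each double zeta value.
    rw [coeff_mul, Finset.Nat.sum_antidiagonal_eq_sum_range_succ_mk, Finset.sum_range_succ,
      Finset.sum_range_one]
    simp only [coeff_sum_shiftInv, coeff_shiftInv_pow, Nat.choose_succ_self_right]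
    simp
    ring

theorem mainTheorem10 (k : ℕ) (hk : 1 ≤ k) :
    (Summable (fun n : ℕ => genHarmonic 1 n * elemPolyHarmonic k n / ((n : ℝ) + 1) ^ 2) ∧
      ∑' n : ℕ, genHarmonic 1 n * elemPolyHarmonic k n / ((n : ℝ) + 1) ^ 2 =
        ((k : ℝ) + 2) * multiZeta ![k + 3] - multiZeta ![k + 2, 1]) ∧
    (Summable (fun n : ℕ+ => (genHarmonic 1 n ^ 2 + genHarmonic 2 n) * elemPolyHarmonic k n /
        ((n : ℝ) + 1) ^ 2) ∧
      1 / 2 * ∑' n : ℕ+, (genHarmonic 1 n ^ 2 + genHarmonic 2 n) * elemPolyHarmonic k n /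
          ((n : ℝ) + 1) ^ 2 =
        ((k + 3).choose 2 : ℝ) * multiZeta ![k + 4] - ((k : ℝ) + 2) * multiZeta ![k + 3, 1] -
          multiZeta ![k + 2, 2]) := by
  have h1 : HasSum (fun n : ℕ => genHarmonic 1 n * elemPolyHarmonic k n / ((n : ℝ) + 1) ^ 2)
      (((k : ℝ) + 2) * multiZeta ![k + 3] - multiZeta ![k + 2, 1]) := by
    refine ((hasSum_elemPolyHarmonic_genHarmonic_succ k).sub
      (hasSum_elemPolyHarmonic_div_cube hk)).of_eq (fun n => ?_) rfl
    rw [genHarmonic_succ]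
    field_simp
    ring
  have h2 : HasSum (fun n : ℕ => (genHarmonic 1 n ^ 2 + genHarmonic 2 n) * elemPolyHarmonic k n /
      ((n : ℝ) + 1) ^ 2) (2 * (((k + 3).choose 2 : ℝ) * multiZeta ![k + 4] -
        (multiZeta ![k + 2, 2] + ((k : ℝ) + 2) * multiZeta ![k + 3, 1]))) := by
    -- This is `h_2(n) = h_2(n+1) - h_1(n+1)/(n+1)`; the factor 2 clears the half in `h_2`.
    refine (((hasSum_elemPolyHarmonic_complete_succ k).sub
      (hasSum_elemPolyHarmonic_genHarmonic_succ_div_cube hk)).mul_left 2).of_eq (fun n => ?_) rfl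
    rw [genHarmonic_succ, genHarmonic_succ]
    field_simp
    ring
  -- Restricting to `ℕ+` loses only the term `n = 0`, which vanishes because `H_0 = H_0^{(2)} = 0`.
  have h3 := (PNat.coe_injective.hasSum_iff (fun n hn => ?_)).mpr h2
  · refine ⟨⟨h1.summable, h1.tsum_eq⟩, h3.summable, ?_⟩
    have h4 := h3.tsum_eq
    simp only [Function.comp_def] at h4
    rw [h4]
    ring
  · have : n = 0 := by
      by_contra h0
      exact hn ⟨⟨n, Nat.pos_of_ne_zero h0⟩, rfl⟩
    simp [this, genHarmonic_zero]
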